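/- Let $p$ be an odd prime, let $F$ be a field with separable closure $F_{\mathrm{sep}}$, and let $E/F$ be a cyclic Galois extension of degree $p$ with $E\subseteq F_{\mathrm{sep}}$. Let $G_F=\mathrm{Gal}(F_{\mathrm{sep}}/F)$ with the Krull topology, let $G_E=\mathrm{Gal}(F_{\mathrm{sep}}/E)\le G_F$, let $G_E^p[G_E,G_E]$ be the closed subgroup generated by all $p$-th powers and all commutators of elements of $G_E$, and let $$T_{E/F}=G_F/G_E^p[G_E,G_E]$$ with the quotient topology. Then $T_{E/F}$ has exactly one subgroup $N$ that is maximal among the proper closed subgroups of $T_{E/F}$ and is elementary abelian (that is, abelian of exponent dividing $p$). Moreover, this subgroup is characteristic: every group automorphism of $T_{E/F}$ maps $N$ onto itself. -/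

import Mathlib

/-- For a subgroup `Δ` of a topological group `Γ`, the closed subgroup `Δ^p[Δ,Δ]`: the topological
closure of the subgroup generated by the `p`-th powers of elements of `Δ` and the commutators of
elements of `Δ`. -/
def powComm (p : ℕ) {Γ : Type*} [Group Γ] [TopologicalSpace Γ] [IsTopologicalGroup Γ]
    (Δ : Subgroup Γ) : Subgroup Γ :=
  (Subgroup.closure {g : Γ | ∃ x ∈ Δ, x ^ p = g} ⊔ ⁅Δ, Δ⁆).topologicalClosure

instance powComm_normal (p : ℕ) {Γ : Type*} [Group Γ] [TopologicalSpace Γ] [IsTopologicalGroup Γ]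
    (Δ : Subgroup Γ) [hΔ : Δ.Normal] : (powComm p Δ).Normal := by
  have h : (Subgroup.closure {g : Γ | ∃ x ∈ Δ, x ^ p = g}).Normal := by
    refine ⟨fun n hn g => ?_⟩
    induction hn using Subgroup.closure_induction with
    | mem y hy =>
      obtain ⟨x, hx, rfl⟩ := hy
      exact Subgroup.subset_closure ⟨g * x * g⁻¹, hΔ.conj_mem x hx g, conj_pow⟩
    | one => simp
    | mul x y _ _ hx hy => simpa [mul_assoc] using mul_mem hx hy
    | inv x _ hx => simpa [mul_assoc] using inv_mem hx
  exact Subgroup.is_normal_topologicalClosure _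

/-- The `T`-group `T_{E/F} = G_F / G_E^p[G_E,G_E]` of a Galois extension `E/F` inside the separable
closure of `F`, where `G_F = Gal(F_sep/F)` has the Krull topology and `G_E ≤ G_F` is the
subgroup fixing `E`. It carries the quotient group structure and the quotient topology. -/
abbrev TGroup (p : ℕ) (F : Type*) [Field F] (E : IntermediateField F (SeparableClosure F))
    [IsGalois F E] : Type _ :=
  Gal(SeparableClosure F/F) ⧸ powComm p E.fixingSubgroup

/-- `N` is maximal among the proper closed subgroups of the topological group `T`. -/
def IsMaximalClosed {T : Type*} [Group T] [TopologicalSpace T] (N : Subgroup T) : Prop :=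
  Maximal (fun K : Subgroup T => IsClosed (K : Set T) ∧ K ≠ ⊤) N

/-- `N` is an elementary abelian `p`-group, that is, abelian of exponent dividing `p`. -/
def IsElemAbelian (p : ℕ) {T : Type*} [Group T] (N : Subgroup T) : Prop :=
  (∀ x ∈ N, ∀ y ∈ N, x * y = y * x) ∧ ∀ x ∈ N, x ^ p = 1

/-! Let N₀ be the image of G_E; it is closed of index p, hence maximal, and elementary abelian by
construction. Everything rests on N₀ = {t : t^p = 1}: this set contains every elementary abelian
subgroup, which gives uniqueness, and automorphisms preserve it. What must be shown is that x ∉ G_E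
forces x^p ∉ G_E^p[G_E,G_E]. For this one builds a continuous homomorphism from G_E to a group of
exponent p that does not kill x^p: from an Artin–Schreier root in characteristic p, and otherwise
from a p-th root, using the transfer because E may lack the p-th roots of unity. -/

theorem mem_ker_of_mem_powComm {p : ℕ} {Γ A : Type*} [Group Γ] [TopologicalSpace Γ]
    [IsTopologicalGroup Γ] [CommGroup A] {Δ V : Subgroup Γ} (hV : IsOpen (V : Set Γ))
    (hVΔ : V ≤ Δ) (f : Δ →* A) (hA : ∀ g, f g ^ p = 1)
    (hf : ∀ g : Δ, (g : Γ) ∈ V → f g = 1) {y : Γ} (hyΔ : y ∈ Δ) (hy : y ∈ powComm p Δ) :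
    f ⟨y, hyΔ⟩ = 1 := by
  have hclosed : IsClosed ((f.ker.map Δ.subtype : Subgroup Γ) : Set Γ) := by
    apply Subgroup.isClosed_of_isOpen
    refine Subgroup.isOpen_mono (H₁ := V) (fun v hv => ?_) hV
    exact ⟨⟨v, hVΔ hv⟩, hf _ hv, rfl⟩
  have hle : powComm p Δ ≤ f.ker.map Δ.subtype := by
    refine Subgroup.topologicalClosure_minimal _ (sup_le ?_ ?_) hclosed
    · rw [Subgroup.closure_le]
      rintro _ ⟨x, hx, rfl⟩
      exact ⟨⟨x, hx⟩ ^ p, (map_pow f _ p).trans (hA _), rfl⟩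
    · rw [Subgroup.commutator_le]
      intro a ha b hb
      refine ⟨⟨a, ha⟩ * ⟨b, hb⟩ * ⟨a, ha⟩⁻¹ * ⟨b, hb⟩⁻¹, ?_, rfl⟩
      simp only [SetLike.mem_coe, MonoidHom.mem_ker, map_mul, map_inv]
      rw [mul_comm (f ⟨a, ha⟩), mul_inv_cancel_right, mul_inv_cancel]
  obtain ⟨z, hz, rfl⟩ := hle hy
  exact hz

/-- Since `D` is normal, `y` fixes every coset, so each factor of the transfer is `φ` of a conjugate
of `y`. -/
theorem transfer_eq_pow_of_conj {G A : Type*} [Group G] [CommGroup A] {D : Subgroup G} [hD : D.Normal]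
    [D.FiniteIndex] (φ : D →* A) {y : G} (hy : y ∈ D) (z : A)
    (h : ∀ t : G, φ ⟨t⁻¹ * y * t, by simpa using hD.conj_mem y hy t⁻¹⟩ = z) :
    φ.transfer y = z ^ D.index := by
  let _ := D.fintypeQuotientOfFiniteIndex
  have hq : ∀ q : G ⧸ D, y⁻¹ • q = q := by
    intro q
    induction q using QuotientGroup.induction_on with
    | H t =>
      refine QuotientGroup.eq.mpr ?_
      simpa [mul_assoc] using hD.conj_mem y hy t⁻¹
  rw [MonoidHom.transfer_def φ (default : D.LeftTransversal), Subgroup.leftTransversals.diff,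
    Finset.prod_eq_pow_card (b := z), Subgroup.index_eq_card, Nat.card_eq_fintype_card,
    Finset.card_univ]
  intro q _
  rw [← h ((default : D.LeftTransversal).2.leftQuotientEquiv q)]
  congr 2
  rw [Subgroup.smul_apply_eq_smul_apply_inv_smul, hq, smul_eq_mul, mul_assoc]

/-- Dedekind independence: `x` has order p modulo G_E, so its first p powers restrict to distinct
characters of E. -/
theorem exists_sum_pow_apply_ne_zero {p : ℕ} (hp : p.Prime) {F Ω : Type*} [Field F] [Field Ω]
    [Algebra F Ω] {E : IntermediateField F Ω} [hE : E.fixingSubgroup.Normal] {x : Gal(Ω/F)}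
    (hx : x ∉ E.fixingSubgroup)
    (hxp : x ^ p ∈ E.fixingSubgroup) (c : ℕ → Ω) (hc : c 0 ≠ 0) :
    ∃ e ∈ E, ∑ i ∈ Finset.range p, c i * (x ^ i) e ≠ 0 := by
  let χ : Fin p → (E →* Ω) := fun i => (((x ^ (i : ℕ)).toAlgHom.comp E.val : E →ₐ[F] Ω) : E →* Ω)
  have hχ : Function.Injective χ := by
    intro i j hij
    have hord : orderOf (x : Gal(Ω/F) ⧸ E.fixingSubgroup) = p := by
      have : Fact p.Prime := ⟨hp⟩
      refine orderOf_eq_prime ?_ fun h => hx ((QuotientGroup.eq_one_iff x).mp h)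
      exact (QuotientGroup.eq_one_iff (x ^ p)).mpr hxp
    refine Fin.ext (pow_injOn_Iio_orderOf (x := (x : Gal(Ω/F) ⧸ E.fixingSubgroup))
      (hord ▸ i.2) (hord ▸ j.2) (QuotientGroup.eq.mpr ?_))
    rw [IntermediateField.mem_fixingSubgroup_iff]
    intro e he
    have hval : (x ^ (i : ℕ)) e = (x ^ (j : ℕ)) e := DFunLike.congr_fun hij ⟨e, he⟩
    rw [AlgEquiv.mul_apply, ← hval, ← AlgEquiv.mul_apply, inv_mul_cancel, AlgEquiv.one_apply]
  by_contra! h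
  have hli := (linearIndependent_monoidHom E Ω).comp χ hχ
  rw [Fintype.linearIndependent_iff] at hli
  refine hc (hli (fun i => c i) ?_ ⟨0, hp.pos⟩)
  ext e
  have := h e e.2
  rw [Finset.sum_range] at this
  simpa [χ] using this

theorem pow_apply_of_kummer {p : ℕ} (hp : p.Prime) (hp2 : 2 < p) {F Ω : Type*} [Field F] [Field Ω]
    [Algebra F Ω] {x : Gal(Ω/F)} {ζ β : Ω} (hζ : IsPrimitiveRoot ζ p) (hxζ : x ζ = ζ) (hβ : β ≠ 0)
    (h : x (β ^ p) = ζ * β ^ p) : (x ^ p) β = ζ * β := by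
  have hroot : ∀ w : Ω, w ^ p = 1 → x w = w := by
    intro w hw
    have : NeZero p := ⟨hp.ne_zero⟩
    obtain ⟨k, -, rfl⟩ := hζ.eq_pow_of_pow_eq_one hw
    rw [map_pow, hxζ]
  obtain ⟨η, hη⟩ : ∃ η, x β = η * β := ⟨x β / β, by field_simp⟩
  have hηp : η ^ p = ζ := by
    rw [map_pow, hη, mul_pow] at h
    exact mul_right_cancel₀ (pow_ne_zero p hβ) h
  have hζ0 : ζ ≠ 0 := hζ.ne_zero hp.ne_zero
  have hη0 : η ≠ 0 := by
    rintro rfl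
    exact hζ0 (by rw [← hηp, zero_pow hp.ne_zero])
  obtain ⟨ω, hω⟩ : ∃ ω, x η = ω * η := ⟨x η / η, by field_simp⟩
  have hωp : ω ^ p = 1 := by
    have := congrArg (· ^ p) hω
    simp only [← map_pow, mul_pow, hηp, hxζ] at this
    exact mul_right_cancel₀ hζ0 (by rw [← this, one_mul])
  -- At n = p the factor in `ω` disappears because p divides `p.choose 2`; this is where p odd
  -- enters.
  have key : ∀ n : ℕ, (x ^ n) β = η ^ n * ω ^ (n.choose 2) * β := by
    intro n
    induction n with
    | zero => simp
    | succ n ih =>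
      rw [pow_succ', AlgEquiv.mul_apply, ih, Nat.choose_succ_succ' n 1, Nat.choose_one_right]
      simp only [map_mul, map_pow, hη, hω, hroot ω hωp]
      ring
  obtain ⟨k, hk⟩ := hp.dvd_choose_self two_ne_zero hp2
  rw [key, hηp, hk, pow_mul, hωp, one_pow, mul_one]

theorem sum_range_shift {M : Type*} [AddCommGroup M] (f : ℕ → M) (n : ℕ) (h : f n = f 0) :
    ∑ i ∈ Finset.range n, f (i + 1) = ∑ i ∈ Finset.range n, f i := by
  have := Finset.sum_range_succ f n
  rw [Finset.sum_range_succ', h] at this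
  exact add_right_cancel this

/-! ### Characteristic p: Artin–Schreier theory. -/

theorem pow_notMem_powComm_of_charP {p : ℕ} (hp : p.Prime) {F Ω : Type*} [Field F] [Field Ω]
    [Algebra F Ω] [Algebra.IsIntegral F Ω] [IsSepClosed Ω] [CharP Ω p] {E : IntermediateField F Ω}
    [hE : E.fixingSubgroup.Normal] (hopen : IsOpen (E.fixingSubgroup : Set Gal(Ω/F)))
    {x : Gal(Ω/F)} (hx : x ∉ E.fixingSubgroup) (hxp : x ^ p ∈ E.fixingSubgroup) :
    x ^ p ∉ powComm p E.fixingSubgroup := by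
  have : Fact p.Prime := ⟨hp⟩
  obtain ⟨e, he, ht⟩ := exists_sum_pow_apply_ne_zero hp hx hxp (fun _ => (1 : Ω)) one_ne_zero
  simp only [one_mul] at ht
  have hpe : (x ^ p) e = e := (IntermediateField.mem_fixingSubgroup_iff _ _).mp hxp e he
  set t : Ω := ∑ i ∈ Finset.range p, (x ^ i) e with htdef
  have hfix : ∀ g ∈ E.fixingSubgroup, ∀ i : ℕ, g ((x ^ i) e) = (x ^ i) e := by
    intro g hg i
    have h := (IntermediateField.mem_fixingSubgroup_iff _ _).mp (hE.conj_mem g hg (x ^ i)⁻¹) e he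
    rw [inv_inv, mul_assoc, AlgEquiv.mul_apply, AlgEquiv.mul_apply] at h
    simpa [← AlgEquiv.mul_apply] using congrArg (x ^ i) h
  have hts : ∑ i ∈ Finset.range p, (x ^ (i + 1)) e = t :=
    sum_range_shift (fun i => (x ^ i) e) p (by simpa using hpe)
  have hxt : x t = t := by
    nth_rw 1 [htdef]
    rw [map_sum, ← hts]
    simp only [← AlgEquiv.mul_apply, ← pow_succ']
  set S : Ω := ∑ i ∈ Finset.range p, (i : Ω) * (x ^ i) e with hS
  have hxS : x S = S - t := by
    have h := sum_range_shift (fun i => (i : Ω) * (x ^ i) e) p (by simp)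
    rw [← hS] at h
    nth_rw 1 [hS]
    rw [← h, ← hts, ← Finset.sum_sub_distrib, map_sum]
    refine Finset.sum_congr rfl fun i _ => ?_
    rw [map_mul, map_natCast, ← AlgEquiv.mul_apply, ← pow_succ']
    push_cast
    ring
  -- Additive Hilbert 90: this `α` is chosen so that `x α = α + 1`.
  obtain ⟨α, hα⟩ : ∃ α, α = -S / t := ⟨_, rfl⟩
  have hxα : x α = α + 1 := by
    rw [hα, map_div₀, map_neg, hxS, hxt]
    field_simp
    ring
  have hgt : ∀ g ∈ E.fixingSubgroup, g t = t := fun g hg => by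
    rw [htdef, map_sum]
    exact Finset.sum_congr rfl fun i _ => hfix g hg i
  have hgα : ∀ g ∈ E.fixingSubgroup, g α = α := fun g hg => by
    rw [hα, map_div₀, map_neg, hgt g hg, hS, map_sum]
    simp only [map_mul, map_natCast, hfix g hg]
  -- Since e/t has trace 1 and α^p - α is fixed by `x`, the right side has trace α^p - α. So the sum
  -- `γ` of the x^i β differs from `α` by an element of the prime field, and x γ - γ = x^p β - β
  -- equals 1.
  obtain ⟨β, hβ⟩ : ∃ β : Ω, β ^ p - β = (α ^ p - α) * e / t := by
    obtain ⟨β, hβ⟩ := IsSepClosed.exists_root_C_mul_X_pow_add_C_mul_X_add_C' p p (1 : Ω) (-1)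
      (-((α ^ p - α) * e / t)) dvd_rfl hp.two_le (by simp)
    exact ⟨β, by linear_combination hβ⟩
  have hprime : ∀ w : Ω, w ^ p - w = 0 → ∀ g : Gal(Ω/F), g w = w := by
    intro w hw g
    have hbot : w ∈ (⊥ : Subfield Ω) := (Subfield.mem_bot_iff_pow_eq_self Ω p).mpr (sub_eq_zero.mp hw)
    exact (bot_le : (⊥ : Subfield Ω) ≤ (g : Ω →+* Ω).eqLocusField (RingHom.id Ω)) hbot
  have hgβ : ∀ g ∈ E.fixingSubgroup, (g β - β) ^ p - (g β - β) = 0 := by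
    intro g hg
    have h := congrArg g hβ
    rw [map_div₀, map_mul, map_sub, map_sub, map_pow, map_pow, hgα g hg, hgt g hg,
      show g e = e by simpa using hfix g hg 0, ← hβ] at h
    rw [sub_pow_char]
    linear_combination h
  have hxα' : x (α ^ p - α) = α ^ p - α := by
    rw [map_sub, map_pow, hxα, add_pow_char, one_pow]
    ring
  obtain ⟨γ, hγ⟩ : ∃ γ, γ = ∑ i ∈ Finset.range p, (x ^ i) β := ⟨_, rfl⟩
  have hγp : (γ - α) ^ p - (γ - α) = 0 := by
    have h1 : γ ^ p - γ = α ^ p - α := by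
      rw [hγ, sum_pow_char, ← Finset.sum_sub_distrib]
      have hpow : ∀ i : ℕ, ∀ w : Ω, x w = w → (x ^ i) w = w := by
        intro i w hw
        exact pow_mem (show x ∈ MulAction.stabilizer Gal(Ω/F) w from hw) i
      have h2 : ∀ i ∈ Finset.range p, ((x ^ i) β) ^ p - (x ^ i) β
          = (α ^ p - α) / t * (x ^ i) e := by
        intro i _
        rw [← map_pow, ← map_sub, hβ, map_div₀, map_mul, hpow i _ hxα', hpow i _ hxt]
        ring
      rw [Finset.sum_congr rfl h2, ← Finset.mul_sum, ← htdef, div_mul_cancel₀ _ ht]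
    rw [sub_pow_char]
    linear_combination h1
  have hxγ : x γ = γ + 1 := by
    have h := hprime _ hγp x
    rw [map_sub, hxα] at h
    linear_combination h
  have hxβ : (x ^ p) β = β + 1 := by
    have h1 : x γ = ∑ i ∈ Finset.range p, (x ^ (i + 1)) β := by
      rw [hγ, map_sum]
      simp only [← AlgEquiv.mul_apply, ← pow_succ']
    have h2 := Finset.sum_range_succ (fun i => (x ^ i) β) p
    rw [Finset.sum_range_succ', ← h1, ← hγ, hxγ, pow_zero, AlgEquiv.one_apply] at h2
    linear_combination -h2
  let f : E.fixingSubgroup →* Multiplicative Ω :=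
    { toFun := fun g => Multiplicative.ofAdd ((g : Gal(Ω/F)) β - β)
      map_one' := by simp
      map_mul' := fun g h => by
        rw [← ofAdd_add]
        congr 1
        have := hprime _ (hgβ h h.2) g
        rw [map_sub] at this
        rw [Subgroup.coe_mul, AlgEquiv.mul_apply]
        linear_combination this }
  intro hmem
  have h := mem_ker_of_mem_powComm (V := E.fixingSubgroup ⊓ MulAction.stabilizer Gal(Ω/F) β)
    (hopen.inter (stabilizer_isOpen_of_isIntegral β)) inf_le_left f
    (fun g => Multiplicative.toAdd.injective (by simp [toAdd_pow])) (fun g hg => ?_) hxp hmem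
  · have : (x ^ p) β - β = 0 := h
    rw [hxβ] at this
    simp at this
  · have : (g : Gal(Ω/F)) β = β := hg.2
    change Multiplicative.ofAdd ((g : Gal(Ω/F)) β - β) = 1
    rw [this, sub_self, ofAdd_zero]

/-! ### Characteristic not p: Kummer theory and transfer. -/

theorem pow_notMem_powComm_of_isPrimitiveRoot {p : ℕ} (hp : p.Prime) (hp2 : 2 < p) {F Ω : Type*}
    [Field F] [Field Ω] [Algebra F Ω] [IsGalois F Ω] [IsSepClosed Ω]
    [NeZero (p : Ω)] {E : IntermediateField F Ω} [FiniteDimensional F E]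
    [hE : E.fixingSubgroup.Normal] {ζ : Ω} (hζ : IsPrimitiveRoot ζ p)
    {x : Gal(Ω/F)} (hx : x ∉ E.fixingSubgroup) (hxp : x ^ p ∈ E.fixingSubgroup) (hxζ : x ζ = ζ) :
    x ^ p ∉ powComm p E.fixingSubgroup := by
  have : Fact p.Prime := ⟨hp⟩
  have : NeZero p := ⟨hp.ne_zero⟩
  have hζ0 : ζ ≠ 0 := hζ.ne_zero hp.ne_zero
  have hroot : ∀ w : Ω, w ^ p = 1 → ∀ g : Gal(Ω/F), g ζ = ζ → g w = w := by
    intro w hw g hg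
    obtain ⟨k, -, rfl⟩ := hζ.eq_pow_of_pow_eq_one hw
    rw [map_pow, hg]
  obtain ⟨e, he, hα0⟩ := exists_sum_pow_apply_ne_zero hp hx hxp (fun i => ζ⁻¹ ^ i) (by simp)
  set α : Ω := ∑ i ∈ Finset.range p, ζ⁻¹ ^ i * (x ^ i) e with hα
  have hpe : (x ^ p) e = e := (IntermediateField.mem_fixingSubgroup_iff _ _).mp hxp e he
  have hxα : x α = ζ * α := by
    have h := sum_range_shift (fun i => ζ⁻¹ ^ i * (x ^ i) e) p (by simp [hpe, hζ.pow_eq_one])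
    rw [← hα] at h
    nth_rw 1 [hα]
    rw [← h, map_sum, Finset.mul_sum]
    refine Finset.sum_congr rfl fun i _ => ?_
    rw [map_mul, map_pow, map_inv₀, hxζ, ← AlgEquiv.mul_apply, ← pow_succ', pow_succ' ζ⁻¹]
    field_simp
  have hfix : ∀ g ∈ E.fixingSubgroup, g ζ = ζ → g α = α := by
    intro g hg hgζ
    rw [hα, map_sum]
    refine Finset.sum_congr rfl fun i _ => ?_
    have h := (IntermediateField.mem_fixingSubgroup_iff _ _).mp (hE.conj_mem g hg (x ^ i)⁻¹) e he
    rw [inv_inv, mul_assoc, AlgEquiv.mul_apply, AlgEquiv.mul_apply] at h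
    have h' : g ((x ^ i) e) = (x ^ i) e := by
      simpa [← AlgEquiv.mul_apply] using congrArg (x ^ i) h
    rw [map_mul, map_pow, map_inv₀, hgζ, h']
  obtain ⟨β, hβ⟩ := IsSepClosed.exists_pow_nat_eq α p
  have hβ0 : β ≠ 0 := by
    rintro rfl
    exact hα0 (by rw [← hβ, zero_pow hp.ne_zero])
  -- On the stabilizer of `ζ` the map g ↦ gβ/β is a homomorphism; its index divides p - 1, so
  -- transferring to G_E loses no p-torsion.
  let D : Subgroup E.fixingSubgroup := ((hζ.autToPow F).comp E.fixingSubgroup.subtype).ker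
  have hD : ∀ g, g ∈ D ↔ (g : Gal(Ω/F)) ζ = ζ := by
    intro g
    rw [MonoidHom.mem_ker, MonoidHom.comp_apply, Subgroup.subtype_apply]
    have hspec := hζ.autToPow_spec F (g : Gal(Ω/F))
    constructor
    · intro h
      rw [← hspec, h, Units.val_one, ZMod.val_one, pow_one]
    · intro h
      rw [h] at hspec
      refine Units.ext (ZMod.val_injective p ?_)
      rw [Units.val_one, ZMod.val_one]
      exact hζ.pow_inj (ZMod.val_lt _) hp.one_lt (hspec.trans (pow_one ζ).symm)
  have hindex : D.index ∣ p - 1 := by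
    rw [Subgroup.index_ker, ← ZMod.card_units p, ← Nat.card_eq_fintype_card]
    exact Subgroup.card_subgroup_dvd_card _
  have hpindex : ¬ p ∣ D.index := fun h =>
    Nat.not_dvd_of_pos_of_lt (Nat.sub_pos_of_lt hp.one_lt) (Nat.sub_lt hp.pos one_pos)
      (h.trans hindex)
  have : D.FiniteIndex := ⟨fun h => hpindex (h ▸ dvd_zero p)⟩
  have hDβ : ∀ d ∈ D, ((d : Gal(Ω/F)) β / β) ^ p = 1 := by
    intro d hd
    rw [div_pow, ← map_pow, hβ, hfix d d.2 ((hD d).mp hd), div_self hα0]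
  let φ : D →* rootsOfUnity p Ω :=
    { toFun := fun d => rootsOfUnity.mkOfPowEq (((d : E.fixingSubgroup) : Gal(Ω/F)) β / β)
        (hDβ d d.2)
      map_one' := by
        ext
        simp [hβ0]
      map_mul' := fun d d' => by
        ext
        have h := hroot _ (hDβ d' d'.2) d ((hD d).mp d.2)
        rw [map_div₀] at h
        have hd0 : ((d : E.fixingSubgroup) : Gal(Ω/F)) β ≠ 0 := by simpa using hβ0
        simp only [rootsOfUnity.coe_mkOfPowEq, Subgroup.coe_mul, Units.val_mul, AlgEquiv.mul_apply]
        rw [← h]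
        field_simp }
  have hφ : ∀ d : D, (((φ d : rootsOfUnity p Ω) : Ωˣ) : Ω) =
      ((d : E.fixingSubgroup) : Gal(Ω/F)) β / β := fun d => rootsOfUnity.coe_mkOfPowEq _
  -- Normality of `W` makes all conjugates of its open fixing subgroup fix `β`, so the transfer is
  -- trivial there.
  obtain ⟨W, hWn, hWfin, hEW, hζW, hβW⟩ : ∃ W : IntermediateField F Ω, Normal F W ∧
      FiniteDimensional F W ∧ E ≤ W ∧ ζ ∈ W ∧ β ∈ W := by
    have := IntermediateField.adjoin.finiteDimensional (Algebra.IsIntegral.isIntegral (R := F) ζ)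
    have := IntermediateField.adjoin.finiteDimensional (Algebra.IsIntegral.isIntegral (R := F) β)
    let M := E ⊔ IntermediateField.adjoin F {ζ} ⊔ IntermediateField.adjoin F {β}
    have hM : M ≤ IntermediateField.normalClosure F M Ω := M.le_normalClosure
    exact ⟨IntermediateField.normalClosure F M Ω, inferInstance, inferInstance,
      (le_sup_left.trans le_sup_left).trans hM,
      hM ((le_sup_right.trans le_sup_left : IntermediateField.adjoin F {ζ} ≤ M)
        (IntermediateField.mem_adjoin_simple_self F ζ)),
      hM ((le_sup_right : IntermediateField.adjoin F {β} ≤ M)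
        (IntermediateField.mem_adjoin_simple_self F β))⟩
  have hWE : W.fixingSubgroup ≤ E.fixingSubgroup := IntermediateField.fixingSubgroup_le hEW
  have hWnormal : W.fixingSubgroup.Normal := by
    have : Algebra.IsSeparable F W := Algebra.isSeparable_tower_bot_of_isSeparable F W Ω
    have : IsGalois F W := ⟨⟩
    infer_instance
  intro hmem
  have hker := mem_ker_of_mem_powComm (V := W.fixingSubgroup) W.fixingSubgroup_isOpen hWE φ.transfer
    (fun g => Subtype.ext (φ.transfer g).2) (fun g hg => ?_) hxp hmem
  · have hxn : ∀ t : E.fixingSubgroup, ((t⁻¹ * x * t : Gal(Ω/F)) ^ p) β = ζ * β := by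
      intro t
      have hyζ : (t⁻¹ * x * t : Gal(Ω/F)) ζ = ζ := by
        rw [← hζ.autToPow_spec F]
        have h1 : hζ.autToPow F (t⁻¹ * x * t : Gal(Ω/F)) = hζ.autToPow F x := by
          rw [map_mul, map_mul, mul_right_comm, ← map_mul, Subgroup.coe_inv, inv_mul_cancel,
            map_one, one_mul]
        rw [h1, hζ.autToPow_spec F, hxζ]
      refine pow_apply_of_kummer hp hp2 hζ hyζ hβ0 ?_
      -- The conjugate differs from `x` by an element fixing E and `ζ`, hence `α`, so it too
      -- multiplies `α` by `ζ`.
      have hh : x⁻¹ * (t⁻¹ * x * t) ∈ E.fixingSubgroup := by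
        have := mul_mem (hE.conj_mem _ (inv_mem t.2) x⁻¹) t.2
        simpa [mul_assoc] using this
      have hhζ : (x⁻¹ * (t⁻¹ * x * t : Gal(Ω/F))) ζ = ζ := by
        rw [AlgEquiv.mul_apply, hyζ]
        nth_rw 1 [← hxζ]
        rw [← AlgEquiv.mul_apply, inv_mul_cancel, AlgEquiv.one_apply]
      have h := congrArg x (hfix _ hh hhζ)
      rw [← AlgEquiv.mul_apply, mul_inv_cancel_left, hxα] at h
      rw [hβ, h]
    have hxD : (⟨x ^ p, hxp⟩ : E.fixingSubgroup) ∈ D := by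
      rw [hD]
      exact pow_mem (show x ∈ MulAction.stabilizer Gal(Ω/F) ζ from hxζ) p
    have htr := transfer_eq_pow_of_conj φ hxD hζ.toRootsOfUnity fun t => by
      ext
      rw [hφ]
      rw [div_eq_iff hβ0]
      refine Eq.trans ?_ (hxn t)
      have hconj := conj_pow (i := p) (a := (t : Gal(Ω/F))⁻¹) (b := x)
      rw [inv_inv] at hconj
      rw [Subgroup.coe_inv, hconj]
      rfl
    rw [hker] at htr
    have h1 : ζ ^ D.index = 1 := by
      have := congrArg (fun u : rootsOfUnity p Ω => ((u : Ωˣ) : Ω)) htr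
      simpa using this.symm
    exact hpindex ((hζ.pow_eq_one_iff_dvd _).mp h1)
  · have hgD : g ∈ D := (hD g).mpr ((IntermediateField.mem_fixingSubgroup_iff _ _).mp hg ζ hζW)
    have htr := transfer_eq_pow_of_conj φ hgD 1 fun t => by
      ext
      rw [hφ]
      have := (IntermediateField.mem_fixingSubgroup_iff _ _).mp
        (hWnormal.conj_mem g hg (t⁻¹ : Gal(Ω/F))) β hβW
      rw [inv_inv] at this
      rw [div_eq_iff hβ0]
      simpa using this
    rw [htr, one_pow]

/-! ### Combining the cases; the p-torsion description of N₀. -/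

theorem pow_notMem_powComm {p : ℕ} (hp : p.Prime) (hp2 : 2 < p) {F Ω : Type*}
    [Field F] [Field Ω] [Algebra F Ω] [IsGalois F Ω] [IsSepClosed Ω]
    {E : IntermediateField F Ω} [FiniteDimensional F E] [hE : E.fixingSubgroup.Normal]
    {x : Gal(Ω/F)} (hx : x ∉ E.fixingSubgroup) (hxp : x ^ p ∈ E.fixingSubgroup) :
    x ^ p ∉ powComm p E.fixingSubgroup := by
  have : Fact p.Prime := ⟨hp⟩
  have : NeZero p := ⟨hp.ne_zero⟩
  by_cases hchar : (p : Ω) = 0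
  · have : CharP Ω p := CharP.ringChar_of_prime_eq_zero hp hchar ▸ ringChar.charP Ω
    exact pow_notMem_powComm_of_charP hp E.fixingSubgroup_isOpen hx hxp
  · have : NeZero (p : Ω) := ⟨hchar⟩
    obtain ⟨ζ, hζ⟩ : ∃ ζ : Ω, IsPrimitiveRoot ζ p := by
      exact HasEnoughRootsOfUnity.exists_primitiveRoot Ω p
    -- Galois acts on `ζ` through a group of order p - 1, so x^(p-1) can replace `x`.
    have hxζ : (x ^ (p - 1)) ζ = ζ := by
      rw [← hζ.autToPow_spec F, map_pow, ZMod.units_pow_card_sub_one_eq_one, Units.val_one,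
        ZMod.val_one, pow_one]
    have hx' : x ^ (p - 1) ∉ E.fixingSubgroup := by
      intro h
      apply hx
      have h2 := mul_mem (inv_mem h) hxp
      have h3 : x ^ p = x ^ (p - 1) * x := by rw [← pow_succ, Nat.sub_add_cancel hp.one_le]
      rwa [h3, inv_mul_cancel_left] at h2
    have hcomm : (x ^ (p - 1)) ^ p = (x ^ p) ^ (p - 1) := pow_right_comm x _ _
    intro h
    refine pow_notMem_powComm_of_isPrimitiveRoot hp hp2 hζ hx' ?_ hxζ ?_
    · rw [hcomm]
      exact pow_mem hxp _
    · rw [hcomm]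
      exact pow_mem h _

theorem mainTheorem6 (p : ℕ) (hp : p.Prime) (hp2 : 2 < p) (F : Type*) [Field F]
    (E : IntermediateField F (SeparableClosure F)) [IsGalois F E]
    (hcyc : IsCyclic Gal(E/F)) (hdeg : Module.finrank F E = p) :
    (∃! N : Subgroup (TGroup p F E), IsMaximalClosed N ∧ IsElemAbelian p N) ∧
    ∀ N : Subgroup (TGroup p F E), IsMaximalClosed N → IsElemAbelian p N → N.Characteristic := by
  have hfd : FiniteDimensional F E :=
    FiniteDimensional.of_finrank_pos (hdeg.symm ▸ hp.pos)
  let C : Subgroup Gal(SeparableClosure F/F) := E.fixingSubgroup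
  let π : Gal(SeparableClosure F/F) →* TGroup p F E := QuotientGroup.mk' (powComm p C)
  have hπ : Function.Surjective π := QuotientGroup.mk'_surjective _
  have hindex : C.index = p := by
    rw [← hdeg]
    exact (IntermediateField.finrank_eq_fixingSubgroup_index _ E).symm
  have hCclosed : IsClosed (C : Set Gal(SeparableClosure F/F)) :=
    Subgroup.isClosed_of_isOpen _ E.fixingSubgroup_isOpen
  have hpow : ∀ x : Gal(SeparableClosure F/F), x ^ p ∈ C := fun x => by
    have := C.pow_index_mem x
    rwa [hindex] at this
  have hle : powComm p C ≤ C := by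
    refine Subgroup.topologicalClosure_minimal _ (sup_le ?_ (Subgroup.commutator_le_self C)) hCclosed
    rw [Subgroup.closure_le]
    rintro _ ⟨x, -, rfl⟩
    exact hpow x
  let N₀ : Subgroup (TGroup p F E) := C.map π
  have hcomap : N₀.comap π = C := by
    rw [Subgroup.comap_map_eq, QuotientGroup.ker_mk', sup_eq_left]
    exact hle
  have hmem : ∀ x, π x ∈ N₀ ↔ x ∈ C := fun x => by rw [← Subgroup.mem_comap, hcomap]
  have hN₀index : N₀.index = p := by
    rw [← Subgroup.index_comap_of_surjective N₀ hπ, hcomap, hindex]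
  have hN₀closed : IsClosed (N₀ : Set (TGroup p F E)) := by
    rw [← QuotientGroup.isOpenQuotientMap_mk.isQuotientMap.isClosed_preimage]
    have : (QuotientGroup.mk : _ → TGroup p F E) ⁻¹' (N₀ : Set (TGroup p F E)) = C :=
      Set.ext hmem
    rwa [this]
  have hN₀pow : ∀ t : TGroup p F E, t ∈ N₀ ↔ t ^ p = 1 := by
    intro t
    obtain ⟨x, rfl⟩ := hπ t
    have h1 : π x ^ p = 1 ↔ x ^ p ∈ powComm p C := by
      rw [← map_pow]
      exact QuotientGroup.eq_one_iff _
    rw [hmem, h1]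
    refine ⟨fun hx => ?_, fun hx => ?_⟩
    · exact Subgroup.le_topologicalClosure _
        ((le_sup_left : Subgroup.closure _ ≤ _) (Subgroup.subset_closure ⟨x, hx, rfl⟩))
    · by_contra hxC
      exact pow_notMem_powComm hp hp2 hxC (hpow x) hx
  have hN₀elem : IsElemAbelian p N₀ := by
    refine ⟨?_, fun t ht => (hN₀pow t).mp ht⟩
    rintro _ ⟨x, hx, rfl⟩ _ ⟨y, hy, rfl⟩
    rw [← commutatorElement_eq_one_iff_mul_comm, ← map_commutatorElement]
    refine (QuotientGroup.eq_one_iff _).mpr (Subgroup.le_topologicalClosure _ ?_)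
    exact (le_sup_right : ⁅C, C⁆ ≤ _) (Subgroup.commutator_mem_commutator hx hy)
  have hN₀top : N₀ ≠ ⊤ := fun h => by
    rw [h, Subgroup.index_top] at hN₀index
    exact hp.one_lt.ne hN₀index
  have hN₀max : IsMaximalClosed N₀ := by
    refine ⟨⟨hN₀closed, hN₀top⟩, fun K hK hle' => ?_⟩
    have h := Subgroup.relIndex_mul_index hle'
    rw [hN₀index] at h
    rcases (Nat.dvd_prime hp).mp (Dvd.intro _ h) with h1 | h1
    · exact Subgroup.relIndex_eq_one.mp h1
    · rw [h1] at h
      exact (hK.2 (Subgroup.index_eq_one.mp (Nat.eq_of_mul_eq_mul_left hp.pos (by rw [h, mul_one])))).elim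
  have huniq : ∀ N : Subgroup (TGroup p F E), IsMaximalClosed N → IsElemAbelian p N → N = N₀ := by
    intro N hN hNe
    have hle' : N ≤ N₀ := fun t ht => (hN₀pow t).mpr (hNe.2 t ht)
    exact le_antisymm hle' (hN.2 ⟨hN₀closed, hN₀top⟩ hle')
  refine ⟨⟨N₀, ⟨hN₀max, hN₀elem⟩, fun N hN => huniq N hN.1 hN.2⟩, fun N hN hNe => ?_⟩
  rw [huniq N hN hNe]
  refine ⟨fun φ => Subgroup.ext fun t => ?_⟩
  rw [Subgroup.mem_comap, hN₀pow, hN₀pow, MulEquiv.coe_toMonoidHom, ← map_pow,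
    EmbeddingLike.map_eq_one_iff]
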